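/- All rings are associative, not necessarily with unity. Let $R$ be a prime ring, that is, $R\neq 0$ and $aRb=0$ implies $a=0$ or $b=0$ for $a,b\in R$. Let $Z(R)$ be its center, $Q_s(R)$ its Martindale symmetric ring of quotients, and let $C$ be the extended centroid of $R$, i.e. the center of $Q_s(R)$, which is a field. For $a,b\in Q_s(R)$ put $[a,b]=ab-ba$, and for subsets $A,B$ of $Q_s(R)$ let $[A,B]$ (resp. $AB$) denote the additive subgroup generated by all $[a,b]$ (resp. $ab$) with $a\in A$, $b\in B$; write $[a,B]$ for $[\{a\},B]$. A Lie ideal of $R$ is an additive subgroup $L$ of $R$ with $[L,R]\subseteq L$. The prime ring $R$ is called exceptional if $\operatorname{char} R=2$ and $\dim_C RC=4$. Theorem. Let $R$ be an exceptional prime ring, and let $L$ be a Lie ideal of $R$. Then at least one of the following holds: (1) $L\subseteq Z(R)$; (2) $LC=[a,RC]=Ca+C$ for some $a\in L\setminus Z(R)$; (3) $[RC,RC]\subseteq LC$. -/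

import Mathlib

/-- An associative ring, not necessarily unital, is prime if it is nonzero and `a R b = 0` forces
`a = 0` or `b = 0`. -/
class IsPrimeRing (R : Type*) [NonUnitalRing R] : Prop where
  exists_ne_zero : ∃ a : R, a ≠ 0
  eq_zero_or_eq_zero : ∀ a b : R, (∀ r : R, a * r * b = 0) → a = 0 ∨ b = 0

/-- The additive subgroup `[A, B]` generated by all commutators `ab - ba`, `a ∈ A`, `b ∈ B`. -/
def commutatorSubgroup {S : Type*} [NonUnitalRing S] (A B : Set S) : AddSubgroup S :=
  AddSubgroup.closure {z | ∃ a ∈ A, ∃ b ∈ B, z = a * b - b * a}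

/-- An additive subgroup `L` of `S` is a Lie ideal if `[L, S] ⊆ L`. -/
def IsLieIdeal {S : Type*} [NonUnitalRing S] (L : AddSubgroup S) : Prop :=
  commutatorSubgroup (L : Set S) Set.univ ≤ L

namespace Martindale

section ideals

variable {R : Type*} [NonUnitalRing R]

/-- The product `I J` of two ideals. -/
def idealMul (I J : TwoSidedIdeal R) : TwoSidedIdeal R :=
  TwoSidedIdeal.span {z | ∃ x ∈ I, ∃ y ∈ J, z = x * y}

theorem mem_idealMul {I J : TwoSidedIdeal R} {z : R} :
    z ∈ idealMul I J ↔ z ∈ AddSubgroup.closure {z | ∃ x ∈ I, ∃ y ∈ J, z = x * y} := by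
  refine TwoSidedIdeal.mem_span_iff_mem_addSubgroup_closure_absorbing ?_ ?_
  · rintro r _ ⟨x, hx, y, hy, rfl⟩
    exact ⟨r * x, I.mul_mem_left _ _ hx, y, hy, (mul_assoc _ _ _).symm⟩
  · rintro _ r ⟨x, hx, y, hy, rfl⟩
    exact ⟨x, hx, y * r, J.mul_mem_right _ _ hy, mul_assoc _ _ _⟩

theorem idealMul_le_left (I J : TwoSidedIdeal R) : idealMul I J ≤ I := by
  refine TwoSidedIdeal.span_le.2 ?_
  rintro _ ⟨x, hx, y, -, rfl⟩
  exact I.mul_mem_right _ _ hx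

theorem idealMul_le_right (I J : TwoSidedIdeal R) : idealMul I J ≤ J := by
  refine TwoSidedIdeal.span_le.2 ?_
  rintro _ ⟨x, -, y, hy, rfl⟩
  exact J.mul_mem_left _ _ hy

theorem exists_mem_ne_zero {I : TwoSidedIdeal R} (hI : I ≠ ⊥) : ∃ x ∈ I, x ≠ 0 := by
  by_contra! h
  exact hI (TwoSidedIdeal.ext fun x =>
    ⟨fun hx => (TwoSidedIdeal.mem_bot R).2 (h x hx), fun hx => by
      rw [(TwoSidedIdeal.mem_bot R).1 hx]; exact I.zero_mem⟩)

theorem ne_bot_of_mem {I : TwoSidedIdeal R} {x : R} (hx : x ∈ I) (h0 : x ≠ 0) : I ≠ ⊥ := by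
  rintro rfl
  exact h0 ((TwoSidedIdeal.mem_bot R).1 hx)

variable [IsPrimeRing R]

theorem top_ne_bot : (⊤ : TwoSidedIdeal R) ≠ ⊥ := by
  obtain ⟨a, ha⟩ := IsPrimeRing.exists_ne_zero (R := R)
  exact ne_bot_of_mem (TwoSidedIdeal.mem_top R) ha

theorem idealMul_ne_bot {I J : TwoSidedIdeal R} (hI : I ≠ ⊥) (hJ : J ≠ ⊥) :
    idealMul I J ≠ ⊥ := by
  obtain ⟨a, ha, ha0⟩ := exists_mem_ne_zero hI
  obtain ⟨b, hb, hb0⟩ := exists_mem_ne_zero hJ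
  have : ∃ r : R, a * r * b ≠ 0 := by
    by_contra! h
    rcases IsPrimeRing.eq_zero_or_eq_zero a b h with h | h
    exacts [ha0 h, hb0 h]
  obtain ⟨r, hr⟩ := this
  exact ne_bot_of_mem (TwoSidedIdeal.subset_span ⟨a * r, I.mul_mem_right _ _ ha, b, hb, rfl⟩) hr

theorem inf_ne_bot {I J : TwoSidedIdeal R} (hI : I ≠ ⊥) (hJ : J ≠ ⊥) : I ⊓ J ≠ ⊥ := by
  obtain ⟨x, hx, h0⟩ := exists_mem_ne_zero (idealMul_ne_bot hI hJ)
  exact ne_bot_of_mem ((TwoSidedIdeal.mem_inf R).2 ⟨idealMul_le_left I J hx, idealMul_le_right I J hx⟩)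
    h0

end ideals

/-- A homomorphism of right `R`-modules `f : I → R` whose domain `I` is a nonzero ideal of `R`.
It is stored as a function on `R`, of which only the values on `I` matter: the values elsewhere
are forgotten in the quotient `RightQuotients` below. -/
structure PartialHom (R : Type*) [NonUnitalRing R] where
  dom : TwoSidedIdeal R
  dom_ne_bot : dom ≠ ⊥
  toFun : R → R
  map_add : ∀ x ∈ dom, ∀ y ∈ dom, toFun (x + y) = toFun x + toFun y
  map_mul_right : ∀ x ∈ dom, ∀ r : R, toFun (x * r) = toFun x * r

namespace PartialHom

variable {R : Type*} [NonUnitalRing R]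

theorem map_zero (f : PartialHom R) : f.toFun 0 = 0 := by
  have := f.map_add 0 f.dom.zero_mem 0 f.dom.zero_mem
  simpa using this

theorem map_neg (f : PartialHom R) {x : R} (hx : x ∈ f.dom) : f.toFun (-x) = -f.toFun x := by
  have := f.map_add x hx (-x) (f.dom.neg_mem hx)
  rw [add_neg_cancel, f.map_zero] at this
  exact (neg_eq_of_add_eq_zero_right this.symm).symm

/-- A right module homomorphism defined on `J` maps `J I` into `I`. -/
theorem map_mem (g : PartialHom R) (I : TwoSidedIdeal R) {z : R} (hz : z ∈ idealMul g.dom I) :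
    g.toFun z ∈ I := by
  have key : z ∈ g.dom ∧ g.toFun z ∈ I := by
    refine AddSubgroup.closure_induction (p := fun z _ => z ∈ g.dom ∧ g.toFun z ∈ I)
      ?_ ?_ ?_ ?_ (mem_idealMul.1 hz)
    · rintro _ ⟨x, hx, y, hy, rfl⟩
      refine ⟨g.dom.mul_mem_right _ _ hx, ?_⟩
      rw [g.map_mul_right x hx]
      exact I.mul_mem_left _ _ hy
    · exact ⟨g.dom.zero_mem, by rw [g.map_zero]; exact I.zero_mem⟩
    · rintro x y - - ⟨hx, hx'⟩ ⟨hy, hy'⟩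
      exact ⟨g.dom.add_mem hx hy, by rw [g.map_add x hx y hy]; exact I.add_mem hx' hy'⟩
    · rintro x - ⟨hx, hx'⟩
      exact ⟨g.dom.neg_mem hx, by rw [g.map_neg hx]; exact I.neg_mem hx'⟩
  exact key.2

/-- Two partial homomorphisms are identified when they agree on a nonzero ideal contained in both
domains. -/
def Rel (f g : PartialHom R) : Prop :=
  ∃ K : TwoSidedIdeal R, K ≠ ⊥ ∧ ∀ x ∈ K, x ∈ f.dom ∧ x ∈ g.dom ∧ f.toFun x = g.toFun x

/-- The pointwise negative. -/
def neg (f : PartialHom R) : PartialHom R where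
  dom := f.dom
  dom_ne_bot := f.dom_ne_bot
  toFun x := -f.toFun x
  map_add x hx y hy := by rw [f.map_add x hx y hy, neg_add]
  map_mul_right x hx r := by rw [f.map_mul_right x hx, neg_mul]

theorem neg_congr {f g : PartialHom R} (h : Rel f g) : Rel f.neg g.neg := by
  obtain ⟨K, hK, h⟩ := h
  exact ⟨K, hK, fun x hx => ⟨(h x hx).1, (h x hx).2.1, congrArg Neg.neg (h x hx).2.2⟩⟩

variable [IsPrimeRing R]

instance setoid (R : Type*) [NonUnitalRing R] [IsPrimeRing R] : Setoid (PartialHom R) where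
  r := Rel
  iseqv :=
    { refl := fun f => ⟨f.dom, f.dom_ne_bot, fun _ hx => ⟨hx, hx, rfl⟩⟩
      symm := fun ⟨K, hK, h⟩ => ⟨K, hK, fun x hx => ⟨(h x hx).2.1, (h x hx).1, (h x hx).2.2.symm⟩⟩
      trans := fun ⟨K, hK, h⟩ ⟨K', hK', h'⟩ => ⟨K ⊓ K', inf_ne_bot hK hK', fun x hx =>
        have hx := (TwoSidedIdeal.mem_inf R).1 hx
        ⟨(h x hx.1).1, (h' x hx.2).2.1, (h x hx.1).2.2.trans (h' x hx.2).2.2⟩⟩ }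

theorem equiv_of_eq {f g : PartialHom R}
    (h : ∀ x ∈ f.dom, x ∈ g.dom → f.toFun x = g.toFun x) : Rel f g :=
  ⟨f.dom ⊓ g.dom, inf_ne_bot f.dom_ne_bot g.dom_ne_bot, fun x hx =>
    have hx := (TwoSidedIdeal.mem_inf R).1 hx
    ⟨hx.1, hx.2, h x hx.1 hx.2⟩⟩

/-- The zero map on `R`. -/
def zero (R : Type*) [NonUnitalRing R] [IsPrimeRing R] : PartialHom R where
  dom := ⊤
  dom_ne_bot := top_ne_bot
  toFun _ := 0
  map_add _ _ _ _ := (add_zero 0).symm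
  map_mul_right _ _ r := (zero_mul r).symm

/-- The identity map of `R`. -/
def one (R : Type*) [NonUnitalRing R] [IsPrimeRing R] : PartialHom R where
  dom := ⊤
  dom_ne_bot := top_ne_bot
  toFun x := x
  map_add _ _ _ _ := rfl
  map_mul_right _ _ _ := rfl

/-- The pointwise sum, on the intersection of the domains. -/
def add (f g : PartialHom R) : PartialHom R where
  dom := f.dom ⊓ g.dom
  dom_ne_bot := inf_ne_bot f.dom_ne_bot g.dom_ne_bot
  toFun x := f.toFun x + g.toFun x
  map_add x hx y hy := by
    rw [TwoSidedIdeal.mem_inf] at hx hy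
    rw [f.map_add x hx.1 y hy.1, g.map_add x hx.2 y hy.2, add_add_add_comm]
  map_mul_right x hx r := by
    rw [TwoSidedIdeal.mem_inf] at hx
    rw [f.map_mul_right x hx.1, g.map_mul_right x hx.2, add_mul]

/-- The composite `f ∘ g`, on the nonzero ideal `dom g * dom f`, which `g` maps into `dom f`. -/
def comp (f g : PartialHom R) : PartialHom R where
  dom := idealMul g.dom f.dom
  dom_ne_bot := idealMul_ne_bot g.dom_ne_bot f.dom_ne_bot
  toFun x := f.toFun (g.toFun x)
  map_add x hx y hy := by
    rw [g.map_add x (idealMul_le_left _ _ hx) y (idealMul_le_left _ _ hy),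
      f.map_add _ (g.map_mem _ hx) _ (g.map_mem _ hy)]
  map_mul_right x hx r := by
    rw [g.map_mul_right x (idealMul_le_left _ _ hx), f.map_mul_right _ (g.map_mem _ hx)]

/-- Left multiplication by `r`. -/
def mulLeft (r : R) : PartialHom R where
  dom := ⊤
  dom_ne_bot := top_ne_bot
  toFun x := r * x
  map_add x _ y _ := mul_add r x y
  map_mul_right x _ s := (mul_assoc r x s).symm

theorem add_congr {f f' g g' : PartialHom R} (h : Rel f f') (k : Rel g g') :
    Rel (f.add g) (f'.add g') := by
  obtain ⟨K, hK, h⟩ := h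
  obtain ⟨M, hM, k⟩ := k
  refine ⟨K ⊓ M, inf_ne_bot hK hM, fun x hx => ?_⟩
  rw [TwoSidedIdeal.mem_inf] at hx
  obtain ⟨h1, h2, h3⟩ := h x hx.1
  obtain ⟨k1, k2, k3⟩ := k x hx.2
  exact ⟨(TwoSidedIdeal.mem_inf R).2 ⟨h1, k1⟩, (TwoSidedIdeal.mem_inf R).2 ⟨h2, k2⟩,
    congrArg₂ (· + ·) h3 k3⟩

theorem comp_congr {f f' g g' : PartialHom R} (h : Rel f f') (k : Rel g g') :
    Rel (f.comp g) (f'.comp g') := by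
  obtain ⟨K, hK, h⟩ := h
  obtain ⟨M, hM, k⟩ := k
  refine ⟨(f.comp g).dom ⊓ (f'.comp g').dom ⊓ (M ⊓ idealMul g.dom K),
    inf_ne_bot (inf_ne_bot (f.comp g).dom_ne_bot (f'.comp g').dom_ne_bot)
      (inf_ne_bot hM (idealMul_ne_bot g.dom_ne_bot hK)), fun x hx => ?_⟩
  simp only [TwoSidedIdeal.mem_inf] at hx
  obtain ⟨⟨h1, h2⟩, h3, h4⟩ := hx
  refine ⟨h1, h2, ?_⟩
  change f.toFun (g.toFun x) = f'.toFun (g'.toFun x)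
  rw [← (k x h3).2.2]
  exact (h _ (g.map_mem K h4)).2.2

end PartialHom

/-- The right Martindale ring of quotients `Q_r(R)` of a prime ring `R`: right module homomorphisms
from nonzero ideals to `R`, modulo agreement on a nonzero ideal. -/
def RightQuotients (R : Type*) [NonUnitalRing R] [IsPrimeRing R] : Type _ :=
  Quotient (PartialHom.setoid R)

section ring

variable {R : Type*} [NonUnitalRing R] [IsPrimeRing R]

instance : Zero (RightQuotients R) := ⟨Quotient.mk _ (PartialHom.zero R)⟩

instance : One (RightQuotients R) := ⟨Quotient.mk _ (PartialHom.one R)⟩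

instance : Neg (RightQuotients R) := ⟨Quotient.map PartialHom.neg fun _ _ => PartialHom.neg_congr⟩

instance : Add (RightQuotients R) :=
  ⟨Quotient.map₂ PartialHom.add fun _ _ h _ _ k => PartialHom.add_congr h k⟩

instance : Mul (RightQuotients R) :=
  ⟨Quotient.map₂ PartialHom.comp fun _ _ h _ _ k => PartialHom.comp_congr h k⟩

/-- Addition is pointwise and multiplication is composition. -/
instance : Ring (RightQuotients R) where
  add_assoc a b c := by
    induction a, b, c using Quotient.inductionOn₃ with | _ f g h
    exact Quotient.sound (PartialHom.equiv_of_eq fun x _ _ => add_assoc _ _ _)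
  zero_add a := by
    induction a using Quotient.inductionOn with | _ f
    exact Quotient.sound (PartialHom.equiv_of_eq fun x _ _ => zero_add _)
  add_zero a := by
    induction a using Quotient.inductionOn with | _ f
    exact Quotient.sound (PartialHom.equiv_of_eq fun x _ _ => add_zero _)
  add_comm a b := by
    induction a, b using Quotient.inductionOn₂ with | _ f g
    exact Quotient.sound (PartialHom.equiv_of_eq fun x _ _ => add_comm _ _)
  neg_add_cancel a := by
    induction a using Quotient.inductionOn with | _ f
    exact Quotient.sound (PartialHom.equiv_of_eq fun x _ _ => neg_add_cancel _)
  mul_assoc a b c := by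
    induction a, b, c using Quotient.inductionOn₃ with | _ f g h
    exact Quotient.sound (PartialHom.equiv_of_eq fun x _ _ => rfl)
  one_mul a := by
    induction a using Quotient.inductionOn with | _ f
    exact Quotient.sound (PartialHom.equiv_of_eq fun x _ _ => rfl)
  mul_one a := by
    induction a using Quotient.inductionOn with | _ f
    exact Quotient.sound (PartialHom.equiv_of_eq fun x _ _ => rfl)
  zero_mul a := by
    induction a using Quotient.inductionOn with | _ f
    exact Quotient.sound (PartialHom.equiv_of_eq fun x _ _ => rfl)
  mul_zero a := by
    induction a using Quotient.inductionOn with | _ f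
    exact Quotient.sound (PartialHom.equiv_of_eq fun x _ _ => f.map_zero)
  left_distrib a b c := by
    induction a, b, c using Quotient.inductionOn₃ with | _ f g h
    refine Quotient.sound (PartialHom.equiv_of_eq fun x _ hx => ?_)
    obtain ⟨h1, h2⟩ := (TwoSidedIdeal.mem_inf R).1 hx
    exact f.map_add _ (g.map_mem _ h1) _ (h.map_mem _ h2)
  right_distrib a b c := by
    induction a, b, c using Quotient.inductionOn₃ with | _ f g h
    exact Quotient.sound (PartialHom.equiv_of_eq fun x _ _ => rfl)
  nsmul := nsmulRec
  zsmul := zsmulRec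

variable (R) in
/-- The embedding `R → Q_r(R)`, which sends `r` to left multiplication by `r`. -/
def toRightQuotients : R →ₙ+* RightQuotients R where
  toFun r := Quotient.mk _ (PartialHom.mulLeft r)
  map_zero' := Quotient.sound (PartialHom.equiv_of_eq fun x _ _ => zero_mul x)
  map_add' r s := Quotient.sound (PartialHom.equiv_of_eq fun x _ _ => add_mul r s x)
  map_mul' r s := Quotient.sound (PartialHom.equiv_of_eq fun x _ _ => mul_assoc r s x)

variable (R) in
/-- The Martindale symmetric ring of quotients `Q_s(R)` of a prime ring `R`: all `q ∈ Q_r(R)` such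
that `q I ⊆ R` and `I q ⊆ R` for some nonzero ideal `I` of `R`. -/
def symmetricQuotients : Subring (RightQuotients R) where
  carrier := {q | ∃ I : TwoSidedIdeal R, I ≠ ⊥ ∧ ∀ x ∈ I,
    (∃ y, q * toRightQuotients R x = toRightQuotients R y) ∧
    (∃ y, toRightQuotients R x * q = toRightQuotients R y)}
  zero_mem' := ⟨⊤, top_ne_bot, fun x _ => ⟨⟨0, by simp⟩, ⟨0, by simp⟩⟩⟩
  one_mem' := ⟨⊤, top_ne_bot, fun x _ => ⟨⟨x, by simp⟩, ⟨x, by simp⟩⟩⟩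
  neg_mem' := by
    rintro p ⟨I, hI, hp⟩
    refine ⟨I, hI, fun x hx => ?_⟩
    obtain ⟨⟨y, hy⟩, ⟨z, hz⟩⟩ := hp x hx
    exact ⟨⟨-y, by rw [neg_mul, hy, _root_.map_neg]⟩, ⟨-z, by rw [mul_neg, hz, _root_.map_neg]⟩⟩
  add_mem' := by
    rintro p q ⟨I, hI, hp⟩ ⟨J, hJ, hq⟩
    refine ⟨I ⊓ J, inf_ne_bot hI hJ, fun x hx => ?_⟩
    rw [TwoSidedIdeal.mem_inf] at hx
    obtain ⟨⟨y, hy⟩, ⟨z, hz⟩⟩ := hp x hx.1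
    obtain ⟨⟨y', hy'⟩, ⟨z', hz'⟩⟩ := hq x hx.2
    exact ⟨⟨y + y', by rw [add_mul, hy, hy', _root_.map_add]⟩,
      ⟨z + z', by rw [mul_add, hz, hz', _root_.map_add]⟩⟩
  mul_mem' := by
    rintro p q ⟨I, hI, hp⟩ ⟨J, hJ, hq⟩
    refine ⟨idealMul J I, idealMul_ne_bot hJ hI, fun x hx => ?_⟩
    refine AddSubgroup.closure_induction (p := fun x _ =>
      (∃ y, p * q * toRightQuotients R x = toRightQuotients R y) ∧
      (∃ y, toRightQuotients R x * (p * q) = toRightQuotients R y)) ?_ ?_ ?_ ?_ (mem_idealMul.1 hx)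
    · rintro _ ⟨u, hu, v, hv, rfl⟩
      constructor
      · obtain ⟨y, hy⟩ := (hq u hu).1
        obtain ⟨z, hz⟩ := (hp (y * v) (I.mul_mem_left _ _ hv)).1
        exact ⟨z, by rw [← hz, map_mul, map_mul, ← hy]; simp only [mul_assoc]⟩
      · obtain ⟨y, hy⟩ := (hp v hv).2
        obtain ⟨z, hz⟩ := (hq (u * y) (J.mul_mem_right _ _ hu)).2
        exact ⟨z, by rw [← hz, map_mul, map_mul, ← hy]; simp only [mul_assoc]⟩
    · exact ⟨⟨0, by simp⟩, ⟨0, by simp⟩⟩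
    · rintro a b - - ⟨⟨y, hy⟩, ⟨z, hz⟩⟩ ⟨⟨y', hy'⟩, ⟨z', hz'⟩⟩
      exact ⟨⟨y + y', by rw [_root_.map_add, mul_add, hy, hy', _root_.map_add]⟩,
        ⟨z + z', by rw [_root_.map_add, add_mul, hz, hz', _root_.map_add]⟩⟩
    · rintro a - ⟨⟨y, hy⟩, ⟨z, hz⟩⟩
      exact ⟨⟨-y, by rw [_root_.map_neg, mul_neg, hy, _root_.map_neg]⟩,
        ⟨-z, by rw [_root_.map_neg, neg_mul, hz, _root_.map_neg]⟩⟩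

end ring

variable (R : Type*) [NonUnitalRing R] [IsPrimeRing R]

/-- The Martindale symmetric ring of quotients `Q_s(R)`, as a type. -/
abbrev Qs : Type _ := symmetricQuotients R

/-- The embedding of `R` into `Q_s(R)`. -/
def toQs : R →ₙ+* Qs R where
  toFun r := ⟨toRightQuotients R r, ⊤, top_ne_bot, fun x _ =>
    ⟨⟨r * x, (map_mul _ _ _).symm⟩, ⟨x * r, (map_mul _ _ _).symm⟩⟩⟩
  map_zero' := Subtype.ext (_root_.map_zero _)
  map_add' r s := Subtype.ext (_root_.map_add _ r s)
  map_mul' r s := Subtype.ext (map_mul _ r s)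

/-- The embedding of `R` into `Q_s(R)` is injective, so that `R` is a subring of `Q_s(R)`. -/
theorem toQs_injective : Function.Injective (toQs R) := by
  rw [injective_iff_map_eq_zero]
  intro r hr
  have h : Quotient.mk (PartialHom.setoid R) (PartialHom.mulLeft r)
      = Quotient.mk _ (PartialHom.zero R) := congrArg Subtype.val hr
  obtain ⟨K, hK, h⟩ := Quotient.exact h
  obtain ⟨x, hx, hx0⟩ := exists_mem_ne_zero hK
  refine (IsPrimeRing.eq_zero_or_eq_zero r x fun s => ?_).resolve_right hx0
  rw [mul_assoc]
  exact (h (s * x) (K.mul_mem_left _ _ hx)).2.2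

/-- The extended centroid `C` of `R`: the center of `Q_s(R)`. -/
abbrev extendedCentroid : Subring (Qs R) := Subring.center (Qs R)

variable {R}

/-- `A C` for a subset `A` of `R`: the `C`-subspace of `Q_s(R)` generated by `A`. -/
def extendScalars (A : Set R) : Submodule (extendedCentroid R) (Qs R) :=
  Submodule.span (extendedCentroid R) (toQs R '' A)

/-- `A C` is the additive subgroup generated by the products `a c`, `a ∈ A`, `c ∈ C`. -/
theorem extendScalars_toAddSubgroup (A : Set R) :
    (extendScalars A).toAddSubgroup =
      AddSubgroup.closure {z | ∃ a ∈ A, ∃ c ∈ extendedCentroid R, z = toQs R a * c} := by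
  apply le_antisymm
  · intro z hz
    refine Submodule.closure_induction (p := fun z _ => z ∈ AddSubgroup.closure
      {z | ∃ a ∈ A, ∃ c ∈ extendedCentroid R, z = toQs R a * c}) ?_ ?_ ?_ hz
    · exact zero_mem _
    · exact fun x y _ _ hx hy => add_mem hx hy
    · rintro c _ ⟨a, ha, rfl⟩
      exact AddSubgroup.subset_closure ⟨a, ha, c, c.2, (Subring.mem_center_iff.1 c.2 _).symm⟩
  · refine (AddSubgroup.closure_le _).2 ?_
    rintro _ ⟨a, ha, c, hc, rfl⟩
    rw [Subring.mem_center_iff.1 hc]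
    exact Submodule.smul_mem _ (⟨c, hc⟩ : extendedCentroid R)
      (Submodule.subset_span ⟨a, ha, rfl⟩)

variable (R)

/-- The central closure `R C` of `R`. -/
abbrev centralClosure : Submodule (extendedCentroid R) (Qs R) := extendScalars (Set.univ : Set R)

/-- A prime ring `R` is exceptional if `char R = 2` and `dim_C RC = 4`. The characteristic of the
possibly nonunital ring `R` is the exponent of its additive group (`0` if there is none). -/
def IsExceptional : Prop :=
  AddMonoid.exponent R = 2 ∧ Module.rank (extendedCentroid R) (centralClosure R) = 4

end Martindale

/-!
Write `Q = Q_s(R)`. A nonzero ideal `I` of `R` spans a finite-dimensional subspace `J = IC`, which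
is a left ideal of the subalgebra of all `q ∈ Q` with `q J ⊆ J`. That subalgebra is semiprime of
finite dimension, hence semisimple, so `J` has a right identity, which must be `1`. As every `q ∈ Q`
satisfies `q I ⊆ R` for some such `I`, it follows that `Q = RC`, of dimension 4.

Let `a ∈ L` be noncentral. Primeness forces `ad a` to have rank at least 2, while `a` and `1` lie in
its kernel, so the kernel is `Ca + C` and the rank is 2. If the Lie ideal `LC` has codimension at
most 1, the Lie algebra `Q / LC` is abelian, i.e. `[Q, Q] ⊆ LC`. Otherwise `LC = [a, Q] ∋ a` for
reasons of dimension. As `a²` commutes with `a`, it is `sa + n` for some scalars `s`, `n`, whence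
`(ad a)² = ad (a²) = s ad a` in characteristic 2. Applying this to a `y` with `[a, y] = a` gives
`s = 0`, so `[a, Q]` lies in `ker (ad a) = Ca + C`, which has the same dimension.
-/

namespace Martindale

section Quotients

variable {R : Type*} [NonUnitalRing R] [IsPrimeRing R]

theorem toRightQuotients_injective : Function.Injective (toRightQuotients R) := fun _ _ h =>
  toQs_injective R (Subtype.ext h)

/-- The class of a partial homomorphism in `Q_r(R)`. -/
def RightQuotients.mk (f : PartialHom R) : RightQuotients R := Quotient.mk _ f

theorem RightQuotients.mk_mul_toRightQuotients (f : PartialHom R) {x : R} (hx : x ∈ f.dom) :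
    RightQuotients.mk f * toRightQuotients R x = toRightQuotients R (f.toFun x) :=
  Quotient.sound (s := PartialHom.setoid R)
    (PartialHom.equiv_of_eq fun y _ _ => f.map_mul_right x hx y)

theorem RightQuotients.eq_zero_of_mul_ideal {q : RightQuotients R} {I : TwoSidedIdeal R}
    (hI : I ≠ ⊥) (h : ∀ x ∈ I, q * toRightQuotients R x = 0) : q = 0 := by
  induction q using Quotient.inductionOn with | _ f
  refine Quotient.sound ⟨I ⊓ f.dom, inf_ne_bot hI f.dom_ne_bot, fun x hx => ?_⟩
  obtain ⟨hxI, hxf⟩ := (TwoSidedIdeal.mem_inf R).1 hx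
  refine ⟨hxf, TwoSidedIdeal.mem_top R, toRightQuotients_injective ?_⟩
  rw [← mk_mul_toRightQuotients f hxf]
  exact (h x hxI).trans (_root_.map_zero _).symm

theorem Qs.exists_ideal (q : Qs R) : ∃ I : TwoSidedIdeal R, I ≠ ⊥ ∧ ∀ x ∈ I,
    (∃ y, q * toQs R x = toQs R y) ∧ (∃ y, toQs R x * q = toQs R y) := by
  obtain ⟨I, hI, h⟩ := q.2
  refine ⟨I, hI, fun x hx => ?_⟩
  obtain ⟨⟨y, hy⟩, ⟨z, hz⟩⟩ := h x hx
  exact ⟨⟨y, Subtype.ext hy⟩, ⟨z, Subtype.ext hz⟩⟩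

theorem Qs.eq_zero_of_mul_ideal {q : Qs R} {I : TwoSidedIdeal R} (hI : I ≠ ⊥)
    (h : ∀ x ∈ I, q * toQs R x = 0) : q = 0 :=
  Subtype.ext (RightQuotients.eq_zero_of_mul_ideal hI fun x hx => congrArg Subtype.val (h x hx))

theorem Qs.eq_zero_of_ideal_mul {q : Qs R} {I : TwoSidedIdeal R} (hI : I ≠ ⊥)
    (h : ∀ x ∈ I, toQs R x * q = 0) : q = 0 := by
  obtain ⟨K, hK, hq⟩ := q.exists_ideal
  refine Qs.eq_zero_of_mul_ideal hK fun x hx => ?_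
  obtain ⟨y, hy⟩ := (hq x hx).1
  obtain ⟨i, hi, hi0⟩ := exists_mem_ne_zero hI
  have hy0 : y = 0 := by
    refine (IsPrimeRing.eq_zero_or_eq_zero i y fun r => toQs_injective R ?_).resolve_left hi0
    rw [map_mul, ← hy, ← mul_assoc, h _ (I.mul_mem_right _ _ hi), zero_mul, _root_.map_zero]
  rw [hy, hy0, _root_.map_zero]

theorem Qs.exists_mul_toQs_eq {p : Qs R} (hp : p ≠ 0) :
    ∃ x u : R, u ≠ 0 ∧ p * toQs R x = toQs R u := by
  obtain ⟨I, hI, hpI⟩ := p.exists_ideal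
  obtain ⟨x, hx, hx0⟩ : ∃ x ∈ I, p * toQs R x ≠ 0 := by
    by_contra! h
    exact hp (eq_zero_of_mul_ideal hI h)
  obtain ⟨u, hu⟩ := (hpI x hx).1
  exact ⟨x, u, fun h => hx0 (by rw [hu, h, _root_.map_zero]), hu⟩

theorem Qs.exists_toQs_mul_eq {q : Qs R} (hq : q ≠ 0) :
    ∃ y v : R, v ≠ 0 ∧ toQs R y * q = toQs R v := by
  obtain ⟨J, hJ, hqJ⟩ := q.exists_ideal
  obtain ⟨y, hy, hy0⟩ : ∃ y ∈ J, toQs R y * q ≠ 0 := by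
    by_contra! h
    exact hq (eq_zero_of_ideal_mul hJ h)
  obtain ⟨v, hv⟩ := (hqJ y hy).2
  exact ⟨y, v, fun h => hy0 (by rw [hv, h, _root_.map_zero]), hv⟩

theorem Qs.eq_zero_or_eq_zero {p q : Qs R} (h : ∀ r, p * toQs R r * q = 0) : p = 0 ∨ q = 0 := by
  by_contra! ⟨hp, hq⟩
  obtain ⟨x, u, hu0, hu⟩ := exists_mul_toQs_eq hp
  obtain ⟨y, v, hv0, hv⟩ := exists_toQs_mul_eq hq
  refine (IsPrimeRing.eq_zero_or_eq_zero u v fun r => toQs_injective R ?_).elim hu0 hv0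
  calc toQs R (u * r * v) = p * toQs R (x * r * y) * q := by
        simp only [map_mul, ← hu, ← hv, mul_assoc]
    _ = toQs R 0 := by rw [h, _root_.map_zero]

instance : Nontrivial (Qs R) := by
  obtain ⟨a, ha⟩ := IsPrimeRing.exists_ne_zero (R := R)
  exact nontrivial_of_ne (toQs R a) 0 ((map_ne_zero_iff _ (toQs_injective R)).2 ha)

instance : IsPrimeRing (Qs R) where
  exists_ne_zero := exists_ne 0
  eq_zero_or_eq_zero _ _ h := Qs.eq_zero_or_eq_zero fun r => h (toQs R r)

theorem Qs.charP_two (hR : AddMonoid.exponent R = 2) : CharP (Qs R) 2 := by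
  refine CharTwo.of_one_ne_zero_of_two_eq_zero one_ne_zero ?_
  refine eq_zero_of_ideal_mul top_ne_bot fun x _ => ?_
  rw [mul_two, ← _root_.map_add, ← two_nsmul, ← hR, AddMonoid.exponent_nsmul_eq_zero,
    _root_.map_zero]

end Quotients

section ExtendedCentroid

variable {R : Type*} [NonUnitalRing R] [IsPrimeRing R]

theorem mem_extendedCentroid_of_commute {q : Qs R} (h : ∀ r, q * toQs R r = toQs R r * q) :
    q ∈ extendedCentroid R := by
  refine Subring.mem_center_iff.2 fun p => sub_eq_zero.1 ?_
  obtain ⟨I, hI, hp⟩ := p.exists_ideal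
  refine Qs.eq_zero_of_mul_ideal hI fun x hx => ?_
  obtain ⟨y, hy⟩ := (hp x hx).1
  rw [sub_mul, mul_assoc p, h, ← mul_assoc, mul_assoc q, hy, h, sub_self]

theorem toQs_mem_extendedCentroid {a : R} : toQs R a ∈ extendedCentroid R ↔ a ∈ Set.center R := by
  rw [Semigroup.mem_center_iff]
  refine ⟨fun ha r => toQs_injective R ?_, fun ha => mem_extendedCentroid_of_commute fun r => ?_⟩
  · rw [map_mul, map_mul, Subring.mem_center_iff.1 ha]
  · rw [← map_mul, ← map_mul, ha]

theorem isLeftRegular_of_mem_extendedCentroid {c : Qs R} (hc : c ∈ extendedCentroid R)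
    (h0 : c ≠ 0) : IsLeftRegular c :=
  isLeftRegular_iff_right_eq_zero_of_mul.2 fun q h => (Qs.eq_zero_or_eq_zero fun r => by
    rw [← Subring.mem_center_iff.1 hc, mul_assoc, h, mul_zero]).resolve_left h0

theorem PartialHom.exists_extendedCentroid_mul_eq (f : PartialHom R)
    (hf : ∀ x ∈ f.dom, ∀ r, f.toFun (r * x) = r * f.toFun x) :
    ∃ c ∈ extendedCentroid R, ∀ x ∈ f.dom, c * toQs R x = toQs R (f.toFun x) := by
  set q := RightQuotients.mk f
  have hq {x : R} (hx : x ∈ f.dom) : q * toRightQuotients R x = toRightQuotients R (f.toFun x) :=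
    RightQuotients.mk_mul_toRightQuotients f hx
  have hcomm (r : R) : q * toRightQuotients R r = toRightQuotients R r * q := by
    refine sub_eq_zero.1 (RightQuotients.eq_zero_of_mul_ideal f.dom_ne_bot fun x hx => ?_)
    rw [sub_mul, mul_assoc, ← map_mul, hq (f.dom.mul_mem_left _ _ hx), mul_assoc, hq hx, hf x hx,
      map_mul, sub_self]
  let c : Qs R := ⟨q, f.dom, f.dom_ne_bot, fun x hx =>
    ⟨⟨f.toFun x, hq hx⟩, f.toFun x, (hcomm x).symm.trans (hq hx)⟩⟩
  exact ⟨c, mem_extendedCentroid_of_commute fun r => Subtype.ext (hcomm r), fun x hx =>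
    Subtype.ext (hq hx)⟩

/-- The ideal `R ∩ cR` of `R`, for `c` in the extended centroid: it is the domain of the division
by `c`. -/
def multiplesIdeal {c : Qs R} (hc : c ∈ extendedCentroid R) : TwoSidedIdeal R :=
  TwoSidedIdeal.mk' {y | ∃ x, c * toQs R x = toQs R y}
    ⟨0, by rw [_root_.map_zero, mul_zero]⟩
    (by
      rintro _ _ ⟨x, hx⟩ ⟨y, hy⟩
      exact ⟨x + y, by rw [_root_.map_add, mul_add, hx, hy, _root_.map_add]⟩)
    (by
      rintro _ ⟨x, hx⟩
      exact ⟨-x, by rw [_root_.map_neg, mul_neg, hx, _root_.map_neg]⟩)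
    (by
      rintro r _ ⟨x, hx⟩
      exact ⟨r * x, by
        rw [map_mul, map_mul, ← hx, ← mul_assoc, ← mul_assoc, Subring.mem_center_iff.1 hc]⟩)
    (by
      rintro _ r ⟨x, hx⟩
      exact ⟨x * r, by rw [map_mul, map_mul, ← hx, mul_assoc]⟩)

theorem mem_multiplesIdeal {c : Qs R} {hc : c ∈ extendedCentroid R} {y : R} :
    y ∈ multiplesIdeal hc ↔ ∃ x, c * toQs R x = toQs R y :=
  TwoSidedIdeal.mem_mk' ..

theorem multiplesIdeal_ne_bot {c : Qs R} (hc : c ∈ extendedCentroid R) (h0 : c ≠ 0) :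
    multiplesIdeal hc ≠ ⊥ := by
  obtain ⟨x, y, hy0, hy⟩ := Qs.exists_mul_toQs_eq h0
  exact ne_bot_of_mem (mem_multiplesIdeal.2 ⟨x, hy⟩) hy0

theorem exists_extendedCentroid_mul_eq_one {c : Qs R} (hc : c ∈ extendedCentroid R) (h0 : c ≠ 0) :
    ∃ d ∈ extendedCentroid R, c * d = 1 := by
  have hinj : Function.Injective fun x => c * toQs R x :=
    (isLeftRegular_of_mem_extendedCentroid hc h0).comp (toQs_injective R)
  choose! div hdiv using fun y => (mem_multiplesIdeal (hc := hc) (y := y)).1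
  let f : PartialHom R :=
    { dom := multiplesIdeal hc
      dom_ne_bot := multiplesIdeal_ne_bot hc h0
      toFun := div
      map_add x hx y hy := hinj <| by
        simp only [hdiv _ (add_mem hx hy), _root_.map_add, mul_add, hdiv x hx, hdiv y hy]
      map_mul_right x hx r := hinj <| by
        simp only [hdiv _ (TwoSidedIdeal.mul_mem_right _ _ _ hx), map_mul, ← mul_assoc, hdiv x hx] }
  obtain ⟨d, hd, hdf⟩ := f.exists_extendedCentroid_mul_eq fun x hx r => hinj <| by
    change c * toQs R (div (r * x)) = c * toQs R (r * div x)
    rw [hdiv _ (TwoSidedIdeal.mul_mem_left _ _ _ hx), map_mul, map_mul, ← mul_assoc,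
      ← Subring.mem_center_iff.1 hc, mul_assoc, hdiv x hx]
  refine ⟨d, hd, sub_eq_zero.1 ?_⟩
  refine Qs.eq_zero_of_mul_ideal (multiplesIdeal_ne_bot hc h0) fun y hy => ?_
  rw [sub_mul, mul_assoc, hdf y hy, hdiv y hy, one_mul, sub_self]

theorem isField_extendedCentroid : IsField (extendedCentroid R) where
  exists_pair_ne := exists_pair_ne _
  mul_comm := mul_comm
  mul_inv_cancel {c} h0 := by
    obtain ⟨d, hd, hcd⟩ :=
      exists_extendedCentroid_mul_eq_one c.2 fun h => h0 (Subtype.ext h)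
    exact ⟨⟨d, hd⟩, Subtype.ext hcd⟩

end ExtendedCentroid

end Martindale

section SemiprimeRing

variable {S : Type*} [Ring S]

theorem eq_bot_of_isNilpotent_of_semiprime (hS : ∀ x : S, (∀ s, x * s * x = 0) → x = 0)
    {I : Ideal S} (hI : IsNilpotent I) : I = ⊥ := by
  obtain ⟨n, hn⟩ := hI
  replace hn : I ^ (n + 1) = ⊥ := by rw [Submodule.pow_succ, hn, zero_mul, Ideal.zero_eq_bot]
  induction n with
  | zero => rwa [zero_add, Submodule.pow_one] at hn
  | succ k ih =>
    refine ih (eq_bot_iff.2 fun x hx => hS x fun s => ?_)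
    have : x * (s * x) ∈ I ^ (k + 1 + 1) := Submodule.pow_succ (M := I) ▸
      Ideal.mul_mem_mul hx (I.mul_mem_left s (Ideal.pow_le_self k.succ_ne_zero hx))
    rwa [hn, ← mul_assoc] at this

theorem isSemisimpleRing_of_semiprime [IsArtinianRing S]
    (hS : ∀ x : S, (∀ s, x * s * x = 0) → x = 0) : IsSemisimpleRing S :=
  IsArtinianRing.isSemisimpleRing_iff_jacobson.2
    (eq_bot_of_isNilpotent_of_semiprime hS IsSemiprimaryRing.isNilpotent)

theorem exists_mem_forall_mul_eq_of_isSemisimpleRing [IsSemisimpleRing S] (I : Ideal S) :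
    ∃ e ∈ I, ∀ x ∈ I, x * e = x := by
  obtain ⟨e, he, rfl⟩ := IsSemisimpleRing.ideal_eq_span_idempotent I
  refine ⟨e, Ideal.mem_span_singleton_self e, fun x hx => ?_⟩
  obtain ⟨s, rfl⟩ := Ideal.mem_span_singleton'.1 hx
  rw [mul_assoc, he.eq]

end SemiprimeRing

section LeftStabilizer

variable {F Q : Type*} [Ring Q]

section CommRing

variable [CommRing F] [Algebra F Q]

/-- The subalgebra of all `q` with `q J ⊆ J`. It contains `1`, and it contains `J` as a left ideal
when `J` is closed under multiplication. -/
def leftStabilizer (J : Submodule F Q) : Subalgebra F Q where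
  carrier := {q | ∀ y ∈ J, q * y ∈ J}
  mul_mem' hp hq y hy := by rw [mul_assoc]; exact hp _ (hq y hy)
  add_mem' hp hq y hy := by rw [add_mul]; exact J.add_mem (hp y hy) (hq y hy)
  algebraMap_mem' c y hy := by rw [← Algebra.smul_def]; exact J.smul_mem c hy

/-- The left ideal of `leftStabilizer J` formed by the elements that lie in `J`. -/
def stabilizedIdeal (J : Submodule F Q) : Ideal (leftStabilizer J) where
  carrier := {q | (q : Q) ∈ J}
  add_mem' hx hy := J.add_mem hx hy
  zero_mem' := J.zero_mem
  smul_mem' q x hx := q.2 x hx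

end CommRing

variable [Field F] [Algebra F Q]

theorem finiteDimensional_leftStabilizer {J : Submodule F Q} [FiniteDimensional F J]
    (hJ : ∀ q : Q, (∀ y ∈ J, q * y = 0) → q = 0) : FiniteDimensional F (leftStabilizer J) := by
  let φ : leftStabilizer J →ₗ[F] Module.End F J :=
    { toFun q := (LinearMap.mulLeft F (q : Q)).restrict q.2
      map_add' p q := LinearMap.ext fun y => Subtype.ext (add_mul (p : Q) q y)
      map_smul' c q := LinearMap.ext fun y => Subtype.ext (smul_mul_assoc c (q : Q) y) }
  have hφ : Function.Injective φ := (injective_iff_map_eq_zero φ).2 fun q hq =>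
    Subtype.ext (hJ q fun y hy => congrArg Subtype.val (LinearMap.congr_fun hq ⟨y, hy⟩))
  exact Module.Finite.of_injective φ hφ

theorem one_mem_of_mul_le {A J : Submodule F Q}
    (hA : ∀ p q : Q, (∀ x ∈ A, p * x * q = 0) → p = 0 ∨ q = 0) [FiniteDimensional F J]
    (hJ : J ≠ ⊥) (hJA : J * A ≤ J) (hAJ : A * J ≤ J) (hle : J ≤ A) : (1 : Q) ∈ J := by
  have hstab {x : Q} (hx : x ∈ A) : x ∈ leftStabilizer J := fun y hy =>
    hAJ (Submodule.mul_mem_mul hx hy)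
  obtain ⟨j, hj, hj0⟩ := J.exists_mem_ne_zero_of_ne_bot hJ
  have hfaithful (q : Q) (hq : ∀ y ∈ J, q * y = 0) : q = 0 :=
    (hA q j fun x hx => by rw [mul_assoc, hq _ (hstab hx j hj)]).resolve_right hj0
  have := finiteDimensional_leftStabilizer hfaithful
  have : IsArtinianRing (leftStabilizer J) := .of_finite F _
  have : IsSemisimpleRing (leftStabilizer J) := isSemisimpleRing_of_semiprime fun p hp =>
    Subtype.ext (or_self_iff.1 <| hA p p fun x hx => congrArg Subtype.val (hp ⟨x, hstab hx⟩))
  obtain ⟨e, heJ, he⟩ := exists_mem_forall_mul_eq_of_isSemisimpleRing (stabilizedIdeal J)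
  have hje (x : Q) (hx : x ∈ A) : j * x * (1 - e) = 0 := by
    have hjx : j * x ∈ J := hJA (Submodule.mul_mem_mul hj hx)
    rw [mul_sub, mul_one, sub_eq_zero]
    exact (congrArg Subtype.val (he ⟨j * x, hstab (hle hjx)⟩ hjx)).symm
  rw [sub_eq_zero.1 ((hA j _ hje).resolve_left hj0)]
  exact heJ

end LeftStabilizer

section LieAlgebra

variable {F L : Type*} [LieRing L]

theorem isLieAbelian_of_top_isPrincipal [CommRing F] [LieAlgebra F L]
    (h : (⊤ : Submodule F L).IsPrincipal) : IsLieAbelian L where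
  trivial x y := by
    obtain ⟨w, hw⟩ := h
    obtain ⟨c, rfl⟩ := Submodule.mem_span_singleton.1 (hw ▸ Submodule.mem_top (x := x))
    obtain ⟨d, rfl⟩ := Submodule.mem_span_singleton.1 (hw ▸ Submodule.mem_top (x := y))
    rw [smul_lie, lie_smul, lie_self, smul_zero, smul_zero]

theorem lie_mem_of_finrank_quotient_le_one [Field F] [LieAlgebra F L] [FiniteDimensional F L]
    {I : LieIdeal F L} (h : Module.finrank F (L ⧸ I) ≤ 1) (x y : L) : ⁅x, y⁆ ∈ I := by
  have : IsLieAbelian (L ⧸ I) :=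
    isLieAbelian_of_top_isPrincipal (Module.finrank_le_one_iff_top_isPrincipal.1 h)
  rw [← LieSubmodule.Quotient.mk_eq_zero', LieSubmodule.Quotient.mk_bracket]
  exact trivial_lie_zero _ _ _ _

end LieAlgebra

section InnerDerivation

attribute [local instance] LieRing.ofAssociativeRing

open Module LinearMap LieAlgebra

theorem lie_lie_eq_mul_self_lie {Q : Type*} [Ring Q] [CharP Q 2] (a x : Q) :
    ⁅a, ⁅a, x⁆⁆ = ⁅a * a, x⁆ := by
  calc ⁅a, ⁅a, x⁆⁆ = ⁅a * a, x⁆ - (a * x * a + a * x * a) + (x * a * a + x * a * a) := by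
        simp only [Ring.lie_def]
        noncomm_ring
    _ = ⁅a * a, x⁆ := by
        rw [CharTwo.add_self_eq_zero, CharTwo.add_self_eq_zero, sub_zero, add_zero]

variable {F Q : Type*} [Ring Q] {a : Q}

section CommRing

variable [CommRing F] [Algebra F Q]

theorem span_sup_span_one_le_ker_ad : F ∙ a ⊔ F ∙ (1 : Q) ≤ ker (ad F Q a) := by
  rw [sup_le_iff, Submodule.span_singleton_le_iff_mem, Submodule.span_singleton_le_iff_mem,
    mem_ker, mem_ker, ad_apply, ad_apply, lie_self, Ring.lie_def, mul_one, one_mul, sub_self]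
  exact ⟨rfl, rfl⟩

theorem notMem_span_one (ha : a ∉ Subring.center Q) : a ∉ F ∙ (1 : Q) := fun h => ha <| by
  obtain ⟨c, rfl⟩ := Submodule.mem_span_singleton.1 h
  rw [← Algebra.algebraMap_eq_smul_one]
  exact Subring.mem_center_iff.2 fun x => (Algebra.commutes c x).symm

theorem exists_lie_notMem_span [IsPrimeRing Q] {z : Q} (hz : ⁅a, z⁆ ≠ 0) :
    ∃ x, ⁅a, x⁆ ∉ F ∙ ⁅a, z⁆ := by
  -- If `[a, z]` spans `[a, Q]`, then `Q [a, z]` lies in the span of `[a, z]` and `[a, z] z`,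
  -- both of which are annihilated on the left by `a - c` for some scalar `c`.
  by_contra! h
  simp only [Submodule.mem_span_singleton] at h
  choose φ hφ using h
  have hz_mul (x : Q) : x * ⁅a, z⁆ = φ (x * z) • ⁅a, z⁆ - φ x • (⁅a, z⁆ * z) := by
    rw [hφ, ← smul_mul_assoc, hφ]
    simp only [Ring.lie_def]
    noncomm_ring
  set b := a - φ (a * z) • (1 : Q) with hb
  have hbz : b * ⁅a, z⁆ = 0 := by
    rw [hb, sub_mul, smul_mul_assoc, one_mul, hφ]
    simp only [Ring.lie_def]
    noncomm_ring
  have hb0 : b = 0 := (IsPrimeRing.eq_zero_or_eq_zero b ⁅a, z⁆ fun x => by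
    rw [mul_assoc, hz_mul, mul_sub, mul_smul_comm, mul_smul_comm, ← mul_assoc, hbz, zero_mul,
      smul_zero, smul_zero, sub_zero]).resolve_right hz
  refine hz ?_
  rw [sub_eq_zero.1 hb0, smul_lie, Ring.lie_def, one_mul, mul_one, sub_self, smul_zero]

end CommRing

variable [Field F] [Algebra F Q]

theorem finrank_span_sup_span_one (ha : a ∉ F ∙ (1 : Q)) :
    finrank F ↥(F ∙ a ⊔ F ∙ (1 : Q)) = 2 := by
  have : Nontrivial Q := nontrivial_of_ne a 0 fun h => ha (h ▸ zero_mem _)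
  have hli : LinearIndependent F ![1, a] := (LinearIndependent.pair_iff' one_ne_zero).2
    fun c hc => ha (Submodule.mem_span_singleton.2 ⟨c, hc⟩)
  have := finrank_span_eq_card hli
  rwa [Matrix.range_cons_cons_empty, Set.pair_comm, Submodule.span_insert,
    Fintype.card_fin] at this

theorem two_le_finrank_range_ad [IsPrimeRing Q] [FiniteDimensional F Q]
    (ha : a ∉ Subring.center Q) : 2 ≤ finrank F (range (ad F Q a)) := by
  obtain ⟨z, hz⟩ : ∃ z : Q, ⁅a, z⁆ ≠ (0 : Q) := by
    by_contra! h
    exact ha (Subring.mem_center_iff.2 fun x => (sub_eq_zero.1 (h x)).symm)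
  obtain ⟨x, hx⟩ := exists_lie_notMem_span (F := F) hz
  have hlt : F ∙ ⁅a, z⁆ < range (ad F Q a) :=
    SetLike.lt_iff_le_and_exists.2 ⟨(Submodule.span_singleton_le_iff_mem _ _).2
      (mem_range_self (ad F Q a) z), _, mem_range_self (ad F Q a) x, hx⟩
  calc 2 = finrank F (F ∙ ⁅a, z⁆) + 1 := by rw [finrank_span_singleton hz]
    _ ≤ finrank F (range (ad F Q a)) := Submodule.finrank_lt_finrank_of_lt hlt

section FourDimensional

variable [IsPrimeRing Q]

theorem ker_ad_eq_span (hQ : finrank F Q = 4) (ha : a ∉ Subring.center Q) :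
    ker (ad F Q a) = F ∙ a ⊔ F ∙ (1 : Q) := by
  have : FiniteDimensional F Q := .of_finrank_pos (by omega)
  refine (Submodule.eq_of_le_of_finrank_le span_sup_span_one_le_ker_ad ?_).symm
  have := two_le_finrank_range_ad (F := F) ha
  have := finrank_range_add_finrank_ker (ad F Q a)
  rw [finrank_span_sup_span_one (notMem_span_one ha)]
  omega

theorem finrank_range_ad (hQ : finrank F Q = 4) (ha : a ∉ Subring.center Q) :
    finrank F (range (ad F Q a)) = 2 := by
  have : FiniteDimensional F Q := .of_finrank_pos (by omega)
  have h := finrank_range_add_finrank_ker (ad F Q a)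
  rw [ker_ad_eq_span hQ ha, finrank_span_sup_span_one (notMem_span_one ha)] at h
  omega

theorem range_ad_eq_span [CharP Q 2] (hQ : finrank F Q = 4) (ha : a ∉ Subring.center Q)
    (haa : a ∈ range (ad F Q a)) : range (ad F Q a) = F ∙ a ⊔ F ∙ (1 : Q) := by
  have : FiniteDimensional F Q := .of_finrank_pos (by omega)
  have hsq : a * a ∈ F ∙ a ⊔ F ∙ (1 : Q) := by
    rw [← ker_ad_eq_span hQ ha, mem_ker, ad_apply, Ring.lie_def, mul_assoc, sub_self]
  simp only [Submodule.mem_sup, Submodule.mem_span_singleton, exists_exists_eq_and] at hsq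
  obtain ⟨s, n, hsn⟩ := hsq
  have had (x : Q) : ⁅a, ⁅a, x⁆⁆ = s • ⁅a, x⁆ := by
    rw [lie_lie_eq_mul_self_lie, ← hsn, add_lie, smul_lie, smul_lie, Ring.lie_def 1, one_mul,
      mul_one, sub_self, smul_zero, add_zero]
  have hs : s = 0 := by
    obtain ⟨y, hy⟩ := haa
    rw [ad_apply] at hy
    have := had y
    rw [hy, lie_self] at this
    exact (smul_eq_zero.1 this.symm).resolve_right (by rintro rfl; exact ha (zero_mem _))
  rw [← ker_ad_eq_span hQ ha]
  refine Submodule.eq_of_le_of_finrank_eq ?_ ?_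
  · rintro _ ⟨x, rfl⟩
    rw [mem_ker, ad_apply, ad_apply, had, hs, zero_smul]
  · rw [finrank_range_ad hQ ha, ker_ad_eq_span hQ ha,
      finrank_span_sup_span_one (notMem_span_one ha)]

theorem lieIdeal_eq_range_ad_or_lie_mem [CharP Q 2] (hQ : finrank F Q = 4) {V : LieIdeal F Q}
    (haV : a ∈ V) (ha : a ∉ Subring.center Q) :
    (V.toSubmodule = range (ad F Q a) ∧ range (ad F Q a) = F ∙ a ⊔ F ∙ (1 : Q)) ∨
      ∀ x y : Q, ⁅x, y⁆ ∈ V := by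
  have : FiniteDimensional F Q := .of_finrank_pos (by omega)
  by_cases hV : finrank F (Q ⧸ V) ≤ 1
  · exact Or.inr (lie_mem_of_finrank_quotient_le_one hV)
  have hVQ : finrank F (Q ⧸ V) + finrank F V = finrank F Q :=
    V.toSubmodule.finrank_quotient_add_finrank
  have hrange : range (ad F Q a) = V.toSubmodule := by
    refine Submodule.eq_of_le_of_finrank_le ?_ ?_
    · rintro _ ⟨x, rfl⟩
      exact lie_mem_left F Q V a x haV
    · rw [finrank_range_ad hQ ha]
      change finrank F V ≤ 2
      omega
  exact Or.inl ⟨hrange.symm, range_ad_eq_span hQ ha (hrange ▸ haV)⟩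

end FourDimensional

end InnerDerivation

namespace Martindale

variable {R : Type*} [NonUnitalRing R] [IsPrimeRing R]

/-- The field structure on the extended centroid. It is not an instance, because the statements
about `extendScalars` refer to the ring structure of the center. -/
noncomputable abbrev extendedCentroidField : Field (extendedCentroid R) :=
  isField_extendedCentroid.toField

section CentralClosure

theorem extendScalars_mono {A B : Set R} (h : A ⊆ B) : extendScalars A ≤ extendScalars B :=
  Submodule.span_mono (Set.image_mono h)

theorem extendScalars_mul_le {A B D : Set R} (h : ∀ a ∈ A, ∀ b ∈ B, a * b ∈ D) :
    extendScalars A * extendScalars B ≤ extendScalars D := by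
  rw [extendScalars, extendScalars, Submodule.span_mul_span]
  refine Submodule.span_mono ?_
  rintro _ ⟨_, ⟨a, ha, rfl⟩, _, ⟨b, hb, rfl⟩, rfl⟩
  exact ⟨a * b, h a ha b hb, map_mul _ a b⟩

attribute [local instance] extendedCentroidField

theorem one_mem_extendScalars [FiniteDimensional (extendedCentroid R) (centralClosure R)]
    {I : TwoSidedIdeal R} (hI : I ≠ ⊥) : 1 ∈ extendScalars (I : Set R) := by
  have hle : extendScalars (I : Set R) ≤ centralClosure R := extendScalars_mono (Set.subset_univ _)
  have := Submodule.finiteDimensional_of_le hle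
  refine one_mem_of_mul_le (A := centralClosure R) ?_ ?_ ?_ ?_ hle
  · exact fun p q h => Qs.eq_zero_or_eq_zero fun r =>
      h _ (Submodule.subset_span ⟨r, Set.mem_univ r, rfl⟩)
  · obtain ⟨x, hx, hx0⟩ := exists_mem_ne_zero hI
    refine (Submodule.ne_bot_iff _).2 ⟨toQs R x, Submodule.subset_span ⟨x, hx, rfl⟩, ?_⟩
    exact (map_ne_zero_iff _ (toQs_injective R)).2 hx0
  · exact extendScalars_mul_le fun x hx r _ => I.mul_mem_right _ _ hx
  · exact extendScalars_mul_le fun r _ x hx => I.mul_mem_left _ _ hx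

theorem centralClosure_eq_top [FiniteDimensional (extendedCentroid R) (centralClosure R)] :
    centralClosure R = ⊤ := by
  refine Submodule.eq_top_iff'.2 fun q => ?_
  obtain ⟨I, hI, hq⟩ := q.exists_ideal
  have hqI : extendScalars (I : Set R) ≤
      (centralClosure R).comap (LinearMap.mulLeft (extendedCentroid R) q) := by
    refine Submodule.span_le.2 ?_
    rintro _ ⟨x, hx, rfl⟩
    obtain ⟨y, hy⟩ := (hq x hx).1
    exact Submodule.subset_span ⟨y, Set.mem_univ y, hy.symm⟩
  exact mul_one q ▸ hqI (one_mem_extendScalars hI)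

end CentralClosure

section LieIdeal

attribute [local instance] LieRing.ofAssociativeRing

theorem lie_mem_extendScalars {L : AddSubgroup R} (hL : IsLieIdeal L) {x y : Qs R}
    (hx : x ∈ centralClosure R) (hy : y ∈ extendScalars (L : Set R)) :
    ⁅x, y⁆ ∈ extendScalars (L : Set R) := by
  refine Submodule.span_le.2 ?_ (Submodule.map₂_span_span (extendedCentroid R)
    (LieModule.toEnd (extendedCentroid R) (Qs R) (Qs R)).toLinearMap _ _ ▸
      Submodule.apply_mem_map₂ _ hx hy)
  rintro _ ⟨_, ⟨r, -, rfl⟩, _, ⟨l, hl, rfl⟩, rfl⟩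
  have hlr : l * r - r * l ∈ L := hL (AddSubgroup.subset_closure ⟨l, hl, r, trivial, rfl⟩)
  refine Submodule.subset_span ⟨r * l - l * r, neg_sub (l * r) (r * l) ▸ L.neg_mem hlr, ?_⟩
  rw [map_sub, map_mul, map_mul]
  rfl

/-- `LC` as a Lie ideal of `Q_s(R)`, when `RC = Q_s(R)`. -/
def lieIdealExtendScalars (hR : centralClosure R = ⊤) {L : AddSubgroup R} (hL : IsLieIdeal L) :
    LieIdeal (extendedCentroid R) (Qs R) where
  __ := extendScalars (L : Set R)
  lie_mem hy := lie_mem_extendScalars hL (hR ▸ Submodule.mem_top) hy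

theorem commutatorSubgroup_singleton_top (a : Qs R) :
    commutatorSubgroup {a} ((⊤ : Submodule (extendedCentroid R) (Qs R)) : Set (Qs R)) =
      (LinearMap.range (LieAlgebra.ad (extendedCentroid R) (Qs R) a)).toAddSubgroup := by
  refine le_antisymm ((AddSubgroup.closure_le _).2 ?_) ?_
  · rintro _ ⟨_, rfl, x, -, rfl⟩
    exact ⟨x, rfl⟩
  · rintro _ ⟨x, rfl⟩
    exact AddSubgroup.subset_closure ⟨a, rfl, x, Set.mem_univ x, rfl⟩

theorem extendScalars_eq_commutatorSubgroup_or_le (hR : IsExceptional R) {L : AddSubgroup R}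
    (hL : IsLieIdeal L) {a : R} (haL : a ∈ L) (ha : a ∉ Set.center R) :
    ((extendScalars (L : Set R)).toAddSubgroup =
        commutatorSubgroup {toQs R a} (centralClosure R : Set (Qs R)) ∧
      commutatorSubgroup {toQs R a} (centralClosure R : Set (Qs R)) =
        (Submodule.span (extendedCentroid R) {toQs R a} ⊔
          Submodule.span (extendedCentroid R) {1}).toAddSubgroup) ∨
    commutatorSubgroup (centralClosure R : Set (Qs R)) (centralClosure R : Set (Qs R)) ≤
      (extendScalars (L : Set R)).toAddSubgroup := by
  let := extendedCentroidField (R := R)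
  have hdim : Module.finrank (extendedCentroid R) (centralClosure R) = 4 :=
    Module.finrank_eq_of_rank_eq hR.2
  have : FiniteDimensional (extendedCentroid R) (centralClosure R) :=
    .of_finrank_pos (hdim ▸ four_pos)
  have htop : centralClosure R = ⊤ := centralClosure_eq_top
  have := Qs.charP_two hR.1
  have haV : toQs R a ∈ lieIdealExtendScalars htop hL := Submodule.subset_span ⟨a, haL, rfl⟩
  rw [htop, finrank_top] at hdim
  rw [htop, commutatorSubgroup_singleton_top]
  refine (lieIdeal_eq_range_ad_or_lie_mem hdim haV (mt toQs_mem_extendedCentroid.1 ha)).imp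
    (fun h => ⟨congrArg _ h.1, congrArg _ h.2⟩) fun h => (AddSubgroup.closure_le _).2 ?_
  rintro _ ⟨x, -, y, -, rfl⟩
  exact h x y

end LieIdeal

end Martindale

theorem mainTheorem8 {R : Type*} [NonUnitalRing R] [IsPrimeRing R]
    (hR : Martindale.IsExceptional R) (L : AddSubgroup R) (hL : IsLieIdeal L) :
    (L : Set R) ⊆ Set.center R ∨
    (∃ a ∈ L, a ∉ Set.center R ∧
      (Martindale.extendScalars (L : Set R)).toAddSubgroup =
        commutatorSubgroup {Martindale.toQs R a} (Martindale.centralClosure R : Set _) ∧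
      commutatorSubgroup {Martindale.toQs R a} (Martindale.centralClosure R : Set _) =
        (Submodule.span (Martindale.extendedCentroid R) {Martindale.toQs R a} ⊔
          Submodule.span (Martindale.extendedCentroid R) {1}).toAddSubgroup) ∨
    commutatorSubgroup (Martindale.centralClosure R : Set (Martindale.Qs R))
        (Martindale.centralClosure R : Set (Martindale.Qs R)) ≤
      (Martindale.extendScalars (L : Set R)).toAddSubgroup := by
  by_cases hcenter : (L : Set R) ⊆ Set.center R
  · exact Or.inl hcenter
  obtain ⟨a, haL, ha⟩ := Set.not_subset.1 hcenter
  exact Or.inr <| (Martindale.extendScalars_eq_commutatorSubgroup_or_le hR hL haL ha).imp_left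
    fun h => ⟨a, haL, ha, h⟩
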